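/- Let $L/k$ be a finitely generated extension of fields of characteristic zero with $\operatorname{trdeg}_k L \ge 2$. An affine $k$-domain is a commutative integral domain that is a finitely generated $k$-algebra. For a domain $B$ of characteristic zero, $\operatorname{LND}(B)$ denotes the set of locally nilpotent derivations of $B$ (derivations $D : B \to B$ such that for each $x \in B$ there is $n \in \mathbb{N}$ with $D^n(x) = 0$), and $\operatorname{ML}(B) = \bigcap_{D \in \operatorname{LND}(B)} \ker D$. Let $\mathscr{A}_1(B)$ be the set of those subrings $A$ of $B$ of the form $A = \bigcap_{D \in \Delta} \ker D$ with $\Delta \subseteq \operatorname{LND}(B)$ for which $\operatorname{Frac} B$ has transcendence degree $1$ over $\operatorname{Frac} A$; one says that $B$ is semi-rigid if $\mathscr{A}_1(B)$ has at most one element. Then the following are equivalent: (a) there exists an affine $k$-domain $B$ such that $\operatorname{ML}(B) = k$ and $\operatorname{Frac} B = L$; (b) there exists an affine $k$-domain $B$ that is not semi-rigid and satisfies $\operatorname{Frac} B = L$; (c) there exists a field $K$ with $k \subseteq K \subseteq L$ such that $L = K^{(2)}$, i.e. $L$ is $K$-isomorphic to the field of fractions of a polynomial ring in two variables over $K$.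 -/

import Mathlib

/-- The set of locally nilpotent derivations `D : B → B`. A derivation of a ring is an additive map
satisfying the Leibniz rule, that is, a `ℤ`-derivation. -/
def LND (B : Type*) [CommRing B] : Set (Derivation ℤ B B) :=
  {D | ∀ x : B, ∃ n : ℕ, (⇑D)^[n] x = 0}

/-- The kernel of a derivation, as a subring. -/
def derivationKer {B : Type*} [CommRing B] (D : Derivation ℤ B B) : Subring B where
  carrier := {x | D x = 0}
  mul_mem' := by
    intro a b ha hb
    simp only [Set.mem_ofPred_eq] at ha hb ⊢
    simp [ha, hb]
  one_mem' := by simp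
  add_mem' := by
    intro a b ha hb
    simp only [Set.mem_ofPred_eq] at ha hb ⊢
    simp [ha, hb]
  zero_mem' := by simp
  neg_mem' := by
    intro a ha
    simp only [Set.mem_ofPred_eq] at ha ⊢
    simp [ha]

/-- The ring `A_Δ = ⋂_{D ∈ Δ} ker D`; in particular `A_∅ = B`. -/
def kerInter {B : Type*} [CommRing B] (Δ : Set (Derivation ℤ B B)) : Subring B :=
  ⨅ D ∈ Δ, derivationKer D

/-- The Makar-Limanov invariant `ML(B) = ⋂_{D ∈ LND(B)} ker D`. -/
def makarLimanov (B : Type*) [CommRing B] : Subring B :=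
  kerInter (LND B)

/-- The set `𝒜(B) = {A_Δ | Δ ⊆ LND(B)}`. -/
def kerLattice (B : Type*) [CommRing B] : Set (Subring B) :=
  {A | ∃ Δ : Set (Derivation ℤ B B), Δ ⊆ LND B ∧ A = kerInter Δ}

/-- The set `𝒜_n(B) = {A ∈ 𝒜(B) | trdeg_A(B) = n}`. For domains, `Algebra.trdeg A B` is the
transcendence degree of `Frac B` over `Frac A`. -/
def kerLatticeOfTrdeg (B : Type*) [CommRing B] (n : ℕ) : Set (Subring B) :=
  {A | A ∈ kerLattice B ∧ Algebra.trdeg A B = n}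

/-- A domain `B` of characteristic zero is semi-rigid if `|𝒜_1(B)| ≤ 1`. -/
def IsSemiRigid (B : Type*) [CommRing B] [IsDomain B] [CharZero B] : Prop :=
  (kerLatticeOfTrdeg B 1).encard ≤ 1

/-- `L = K^(n)`: the field `L` is, over its subfield `K`, the field of fractions of a polynomial
ring in `n` variables over `K`. -/
def IsRationalFunctionField (K L : Type*) [Field K] [Field L] [Algebra K L] (n : ℕ) : Prop :=
  Nonempty (FractionRing (MvPolynomial (Fin n) K) ≃ₐ[K] L)

/-! ### Locally nilpotent derivations -/

section Iterate

variable {R A : Type*} [CommRing R] [CommRing A] [Algebra R A] (D : Derivation R A A)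

/-! A nonzero locally nilpotent `D` has a local slice `r` (`D r ≠ 0`, `D (D r) = 0`), and Taylor
expansion in `r` puts `B` inside `Frac(ker D)[r]`. Hence the members of `𝒜_1(B)` are exactly the
kernels of nonzero locally nilpotent derivations.

(a) ⇒ (b): in a semi-rigid `B` all these kernels coincide, so they equal `ML(B) = k`, and `L = k(r)`
contradicts `trdeg ≥ 2`.

(b) ⇒ (c): two distinct kernels give `D₁`, `D₂` and `f` with `D₁ f ≠ 0`, `D₂ f = 0`. Let `F` be the
constants of `D₁` in `L` and `s` a slice of `D₁`; then `L = F(s)` and `B ⊆ F[s]`. The top-degree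
part in `s` of `D₂` is a homogeneous derivation, given by a derivation `δ` of `F` and `S ↦ e * S ^
(d + 1)`. It is nilpotent on generators of `F` and kills the leading term of `f`, of positive
degree. This forces `F = F^δ(t)` with `δ t ≠ 0` (`exists_adjoin_constField_eq_top`), so `L = K(s,
t)` with `K = F^δ`.

(c) ⇒ (a): for a suitable finite `T ⊆ K`, take the algebra generated over `k` by all `c * Xᵢ`, `c ∈
T`. The derivations `X₀ ∂₁` and `X₁ ∂₀` preserve it, and their common kernel in it is `k`. -/

theorem Derivation.iterate_add (n : ℕ) (x y : A) : D^[n] (x + y) = D^[n] x + D^[n] y :=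
  iterate_map_add D n x y

theorem Derivation.iterate_mul_of_const {x : A} (hx : D x = 0) (n : ℕ) (y : A) :
    D^[n] (x * y) = x * D^[n] y := by
  induction n generalizing y with
  | zero => rfl
  | succ n ih => simp only [Function.iterate_succ_apply, D.leibniz, hx, smul_eq_mul, mul_zero,
      add_zero, ih]

/-- In Leibniz's formula every term but one differentiates `x` more than `m` times or `y` more than
`n` times. In a domain of characteristic zero, nilpotency degrees therefore add under products. -/
theorem Derivation.iterate_mul_leading (m n : ℕ) {x y : A} (hx : D^[m + 1] x = 0)
    (hy : D^[n + 1] y = 0) :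
    D^[m + n] (x * y) = ((m + n).choose m : A) * (D^[m] x * D^[n] y) := by
  induction hs : m + n generalizing m n x y with
  | zero =>
    obtain ⟨rfl, rfl⟩ : m = 0 ∧ n = 0 := by omega
    simp
  | succ s ih =>
    rcases m with _ | m
    · obtain rfl : n = s + 1 := by omega
      simpa using D.iterate_mul_of_const (by simpa using hx) (s + 1) y
    rcases n with _ | n
    · obtain rfl : m = s := by omega
      rw [mul_comm x y, D.iterate_mul_of_const (by simpa using hy)]
      simp [mul_comm]
    have h1 := ih m (n + 1) (x := D x) (y := y) (by simpa using hx) hy (by omega)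
    have h2 := ih (m + 1) n (x := x) (y := D y) hx (by simpa using hy) (by omega)
    rw [Function.iterate_succ_apply, D.leibniz, smul_eq_mul, smul_eq_mul, D.iterate_add, h2,
      mul_comm y, h1, Nat.choose_succ_succ', ← Function.iterate_succ_apply,
      ← Function.iterate_succ_apply]
    push_cast
    ring

/-- The elements killed by some power of a derivation form a subalgebra. -/
def Derivation.nilSubalgebra : Subalgebra R A where
  carrier := {x | ∃ n, D^[n] x = 0}
  mul_mem' := by
    rintro x y ⟨m, hm⟩ ⟨n, hn⟩
    have hm' : D^[m + 1] x = 0 := by rw [Function.iterate_succ_apply', hm, map_zero]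
    have hn' : D^[n + 1] y = 0 := by rw [Function.iterate_succ_apply', hn, map_zero]
    exact ⟨m + n, by rw [D.iterate_mul_leading m n hm' hn', hm]; simp⟩
  add_mem' := by
    rintro x y ⟨m, hm⟩ ⟨n, hn⟩
    refine ⟨m + n, ?_⟩
    rw [D.iterate_add, add_comm m n, Function.iterate_add_apply, hm, add_comm n m,
      Function.iterate_add_apply, hn, iterate_map_zero, iterate_map_zero, add_zero]
  algebraMap_mem' r := ⟨1, by simp⟩

end Iterate

theorem exists_last_ne_zero {M : Type*} [Zero M] {u : ℕ → M} (h0 : u 0 ≠ 0) (h : ∃ n, u n = 0) :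
    ∃ n, u n ≠ 0 ∧ u (n + 1) = 0 := by
  classical
  rcases hn : Nat.find h with _ | n
  · exact absurd (hn ▸ Nat.find_spec h) h0
  · exact ⟨n, Nat.find_min h (by omega), hn ▸ Nat.find_spec h⟩

section LND

variable {B : Type*} [CommRing B]

theorem mem_derivationKer {D : Derivation ℤ B B} {x : B} : x ∈ derivationKer D ↔ D x = 0 := Iff.rfl

theorem mem_kerInter {Δ : Set (Derivation ℤ B B)} {x : B} :
    x ∈ kerInter Δ ↔ ∀ D ∈ Δ, D x = 0 := by
  simp [kerInter, Subring.mem_iInf, mem_derivationKer]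

theorem exists_local_slice {D : Derivation ℤ B B} (hD : D ∈ LND B) (h0 : D ≠ 0) :
    ∃ r, D r ≠ 0 ∧ D (D r) = 0 := by
  obtain ⟨x, hx⟩ : ∃ x, D x ≠ 0 := by
    by_contra! h
    exact h0 (Derivation.ext h)
  obtain ⟨n, h1, h2⟩ := exists_last_ne_zero (u := fun n => D^[n] (D x)) hx (hD _)
  refine ⟨D^[n] x, ?_, ?_⟩
  · rwa [← Function.iterate_succ_apply' D, Function.iterate_succ_apply]
  · rwa [← Function.iterate_succ_apply' D, ← Function.iterate_succ_apply' D,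
      Function.iterate_succ_apply]

variable [IsDomain B] [CharZero B]

/-- Nilpotency degrees of `x` and of its inverse add up to that of `1`, which is zero. So locally
nilpotent `ℤ`-derivations are automatically linear over any field inside `B`. -/
theorem apply_eq_zero_of_isUnit {D : Derivation ℤ B B} (hD : D ∈ LND B) {x : B} (hx : IsUnit x) :
    D x = 0 := by
  obtain ⟨y, hxy⟩ := hx.exists_right_inv
  have hy0 : y ≠ 0 := by rintro rfl; simp at hxy
  obtain ⟨m, hm, hm'⟩ := exists_last_ne_zero (u := fun n => D^[n] x) hx.ne_zero (hD x)
  obtain ⟨n, hn, hn'⟩ := exists_last_ne_zero (u := fun n => D^[n] y) hy0 (hD y)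
  have h := D.iterate_mul_leading m n hm' hn'
  rw [hxy] at h
  rcases m with _ | m
  · simpa using hm'
  · rw [show m + 1 + n = (m + n) + 1 by ring, Function.iterate_succ_apply, D.map_one_eq_zero,
      iterate_map_zero, eq_comm, mul_eq_zero, mul_eq_zero] at h
    rcases h with h | h | h
    · exact absurd h (by exact_mod_cast (Nat.choose_pos (by omega)).ne')
    · exact absurd h hm
    · exact absurd h hn

end LND

section Algebraic

/-- A derivation that vanishes on the image of a ring `R`, as an `R`-derivation. -/
def Derivation.changeBase {k R A : Type*} [CommRing k] [CommRing R] [CommRing A] [Algebra k A]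
    [Algebra R A] (D : Derivation k A A) (h : ∀ r : R, D (algebraMap R A r) = 0) :
    Derivation R A A :=
  Derivation.mk'
    { toFun := D
      map_add' := map_add D
      map_smul' := fun r x => by simp [Algebra.smul_def, D.leibniz, h] }
    (fun a b => D.leibniz a b)

@[simp]
theorem Derivation.changeBase_apply {k R A : Type*} [CommRing k] [CommRing R] [CommRing A]
    [Algebra k A] [Algebra R A] (D : Derivation k A A) (h : ∀ r : R, D (algebraMap R A r) = 0)
    (x : A) : D.changeBase h x = D x := rfl

variable {R A : Type*} [CommRing R] [CommRing A] [IsDomain A] [CharZero A] [Algebra R A]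

/-- If `p(x) = 0` then `p'(x) * D x = 0`; were `D x ≠ 0`, one could differentiate the relation down
to a nonzero constant. -/
theorem Derivation.apply_eq_zero_of_isAlgebraic [FaithfulSMul R A] (D : Derivation R A A) {x : A}
    (hx : IsAlgebraic R x) : D x = 0 := by
  have := (FaithfulSMul.algebraMap_injective R A).isDomain
  have : CharZero R := (algebraMap R A).charZero
  by_contra h
  obtain ⟨p, hp0, hp⟩ := hx
  induction hn : p.natDegree using Nat.strong_induction_on generalizing p with
  | _ n ih =>
    have h1 := D.map_aeval p x
    rw [hp, map_zero, smul_eq_mul, eq_comm, mul_eq_zero, or_iff_left h] at h1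
    by_cases hd : p.natDegree = 0
    · rw [Polynomial.eq_C_of_natDegree_eq_zero hd, Polynomial.aeval_C] at hp
      rw [FaithfulSMul.algebraMap_eq_zero_iff] at hp
      exact hp0 (by rw [Polynomial.eq_C_of_natDegree_eq_zero hd, hp, map_zero])
    · refine ih _ (hn ▸ Polynomial.natDegree_derivative_lt hd) _ (fun h0 => hd ?_) h1 rfl
      exact Polynomial.derivative_eq_zero.mp h0

end Algebraic

section Slice

variable {R A : Type*} [CommRing R] [CommRing A] [Algebra R A] (D : Derivation R A A)

theorem Derivation.iterate_pow_slice {r : A} (hr : D (D r) = 0) (n : ℕ) :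
    D^[n] (r ^ n) = (n.factorial : A) * D r ^ n := by
  induction n with
  | zero => simp
  | succ n ih =>
    have h : D^[n + 1] (r ^ n) = 0 := by
      rw [Function.iterate_succ_apply', ih]
      simp [D.leibniz, D.leibniz_pow, hr]
    rw [pow_succ, D.iterate_mul_leading n 1 h (by simpa using hr), ih, Nat.choose_succ_self_right,
      Nat.factorial_succ]
    push_cast
    simp only [Function.iterate_one]
    ring

end Slice

/-! ### Local slices, and kernels as the members of `𝒜_1(B)` -/

section Kernel

variable {B : Type*} [CommRing B] {D : Derivation ℤ B B}

theorem kerInter_singleton : kerInter {D} = derivationKer D := by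
  ext x; simp [mem_kerInter, mem_derivationKer]

variable [IsDomain B] [CharZero B]

/-- Taylor expansion in the slice with denominators cleared: if `D^[n+1] b = 0`, then `n! * (D r)^n
* b - D^[n] b * r^n` is killed by `D^[n]`, and induction applies. -/
theorem exists_mul_eq_aeval_slice {r : B} (hr : D r ≠ 0) (hr2 : D (D r) = 0) {b : B}
    (hb : ∃ n, D^[n] b = 0) :
    ∃ u, u ≠ 0 ∧ D u = 0 ∧ ∃ P : Polynomial (derivationKer D), u * b = Polynomial.aeval r P := by
  obtain ⟨n, hn⟩ := hb
  induction n generalizing b with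
  | zero =>
    obtain rfl : b = 0 := hn
    exact ⟨1, one_ne_zero, by simp, 0, by simp⟩
  | succ n ih =>
    set v : B := (n.factorial : B) * D r ^ n with hv
    have hDv : D v = 0 := by simp [hv, D.leibniz, D.leibniz_pow, hr2]
    have hv0 : v ≠ 0 := mul_ne_zero (by exact_mod_cast n.factorial_ne_zero) (pow_ne_zero _ hr)
    have hc : D (D^[n] b) = 0 := by rwa [← Function.iterate_succ_apply' D]
    obtain ⟨u, hu0, hDu, P, hP⟩ := ih (b := v * b - D^[n] b * r ^ n) (by
      rw [iterate_map_sub, D.iterate_mul_of_const hDv, D.iterate_mul_of_const hc,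
        D.iterate_pow_slice hr2, ← hv]
      ring)
    refine ⟨u * v, mul_ne_zero hu0 hv0, by simp [D.leibniz, hDu, hDv],
      P + Polynomial.C (⟨u * D^[n] b, by simp [mem_derivationKer, D.leibniz, hDu, hc]⟩ :
        derivationKer D) * Polynomial.X ^ n, ?_⟩
    rw [map_add, ← hP, map_mul, Polynomial.aeval_C, map_pow, Polynomial.aeval_X]
    change _ = _ + u * D^[n] b * r ^ n
    ring

theorem apply_eq_zero_of_isAlgebraic_kerInter {Δ : Set (Derivation ℤ B B)} (hD : D ∈ Δ) {x : B}
    (hx : IsAlgebraic (kerInter Δ) x) : D x = 0 := by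
  exact (D.changeBase (R := kerInter Δ)
    fun a => mem_kerInter.mp a.2 D hD).apply_eq_zero_of_isAlgebraic hx

theorem transcendental_derivationKer {r : B} (hr : D r ≠ 0) : Transcendental (derivationKer D) r := by
  intro h
  rw [← kerInter_singleton] at h
  exact hr (apply_eq_zero_of_isAlgebraic_kerInter (Set.mem_singleton D) h)

theorem trdeg_derivationKer (hD : D ∈ LND B) (h0 : D ≠ 0) :
    Algebra.trdeg (derivationKer D) B = 1 := by
  obtain ⟨r, hr, hr2⟩ := exists_local_slice hD h0
  refine le_antisymm ?_ ?_
  · have : Algebra.IsAlgebraic (Algebra.adjoin (derivationKer D) {r}) B := by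
      refine ⟨fun b => ?_⟩
      obtain ⟨u, hu0, hDu, P, hP⟩ := exists_mul_eq_aeval_slice hr hr2 (hD b)
      let S := Algebra.adjoin (derivationKer D) {r}
      have hPS : Polynomial.aeval r P ∈ S := Polynomial.aeval_mem_adjoin_singleton _ _
      let u' : S := algebraMap (derivationKer D) S ⟨u, hDu⟩
      have hu' : u' ≠ 0 := fun h => hu0 (congrArg Subtype.val h)
      refine ⟨Polynomial.C u' * Polynomial.X - Polynomial.C ⟨_, hPS⟩, fun h => hu' ?_, ?_⟩
      · simpa using congrArg (fun p => Polynomial.coeff p 1) h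
      · simp only [map_sub, map_mul, Polynomial.aeval_C, Polynomial.aeval_X]
        exact sub_eq_zero.mpr hP
    simpa using Algebra.IsAlgebraic.trdeg_le_cardinalMk (derivationKer D) ({r} : Set B)
  · have := (algebraicIndependent_iff_transcendental.mpr
      (transcendental_derivationKer hr)).lift_cardinalMk_le_trdeg
    simpa using this

/-- For a nonzero `D ∈ Δ`, an element `b` of `ker D` outside `A` is moved by some member of `Δ`,
hence transcendental over `A`. Then `B` would be algebraic over `A[b] ⊆ ker D`, but a slice of `D`
is not. -/
theorem eq_derivationKer_of_trdeg_eq_one {A : Subring B} (hA : A ∈ kerLatticeOfTrdeg B 1) :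
    ∃ D ∈ LND B, D ≠ 0 ∧ A = derivationKer D := by
  obtain ⟨⟨Δ, hΔ, rfl⟩, htr⟩ := hA
  rw [Nat.cast_one] at htr
  obtain ⟨D, hDΔ, hD0⟩ : ∃ D ∈ Δ, D ≠ 0 := by
    by_contra! h
    have halg : Algebra.IsAlgebraic (kerInter Δ) B := ⟨fun b =>
      isAlgebraic_algebraMap (⟨b, mem_kerInter.mpr fun D hD => by simp [h D hD]⟩ : kerInter Δ)⟩
    exact zero_ne_one ((trdeg_eq_zero_iff.mpr halg).symm.trans htr)
  refine ⟨D, hΔ hDΔ, hD0, le_antisymm (fun x hx => mem_kerInter.mp hx D hDΔ) fun b hb => ?_⟩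
  refine mem_kerInter.mpr fun D' hD' => ?_
  by_contra hb'
  have hbt : Transcendental (kerInter Δ) b := fun h =>
    hb' (apply_eq_zero_of_isAlgebraic_kerInter hD' h)
  have hbasis : IsTranscendenceBasis (kerInter Δ) ![b] :=
    ((algebraicIndependent_iff_transcendental (x := b)).mpr
      hbt).isTranscendenceBasis_of_lift_trdeg_le_of_finite (by simp [htr])
  obtain ⟨r, hr, -⟩ := exists_local_slice (hΔ hDΔ) hD0
  have halg := hbasis.isAlgebraic.isAlgebraic r
  refine transcendental_derivationKer hr ?_
  have hle : Algebra.adjoin (kerInter Δ) (Set.range ![b]) ≤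
      Subalgebra.mk (derivationKer D).toSubsemiring
        (fun a => mem_kerInter.mp a.2 D hDΔ) := by
    refine Algebra.adjoin_le ?_
    rintro _ ⟨i, rfl⟩
    have : (![b] i) = b := by simp
    rw [this]
    exact hb
  let φ : Algebra.adjoin (kerInter Δ) (Set.range ![b]) →+* derivationKer D :=
    { toFun := fun x => ⟨x, hle x.2⟩
      map_one' := rfl
      map_mul' := fun _ _ => rfl
      map_zero' := rfl
      map_add' := fun _ _ => rfl }
  obtain ⟨p, hp0, hp⟩ := halg
  have hφ : Function.Injective φ := fun x y h =>
    Subtype.ext (congrArg (fun z : derivationKer D => (z : B)) h)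
  refine ⟨p.map φ, (Polynomial.map_ne_zero_iff hφ).mpr hp0, ?_⟩
  rw [← hp, Polynomial.aeval_def, Polynomial.eval₂_map]
  rfl

end Kernel

/-! ### Twisted derivations of a field -/

section Twisted

variable {k F : Type*} [Field k] [Field F] [Algebra k F]

/-- The field of constants of a derivation. -/
def Derivation.constField (D : Derivation k F F) : IntermediateField k F where
  carrier := {x | D x = 0}
  mul_mem' := by
    intro a b (ha : D a = 0) (hb : D b = 0)
    simp [D.leibniz, ha, hb]
  add_mem' := by
    intro a b (ha : D a = 0) (hb : D b = 0)
    simp [ha, hb]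
  algebraMap_mem' := by simp
  inv_mem' := by
    intro a (ha : D a = 0)
    simp [D.leibniz_inv, ha]

theorem Derivation.transcendental_constField [CharZero F] {D : Derivation k F F} {x : F}
    (hx : D x ≠ 0) : Transcendental D.constField x := fun h => hx <| by
  exact (D.changeBase (R := D.constField) fun a => a.2).apply_eq_zero_of_isAlgebraic h

variable (D : Derivation k F F) (e : F)

/-- The action on coefficients of degree `i` of a homogeneous derivation of `F[S]` that restricts
to `D` on constants and sends `S` to `e * S`, up to powers of `S`. -/
def twisted (i : ℤ) (c : F) : F := D c + i * e * c

/-- The `n`-fold composition of twisted derivations of degrees `i`, `i + d`, `i + 2 * d`, … -/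
def twistedIter (d : ℤ) : ℕ → ℤ → F → F
  | 0, _, c => c
  | n + 1, i, c => twistedIter d n (i + d) (twisted D e i c)

theorem twisted_zero_left (c : F) : twisted D e 0 c = D c := by simp [twisted]

theorem twisted_zero (i : ℤ) : twisted D e i 0 = 0 := by simp [twisted]

/-- Leibniz's rule on coefficients of homogeneous elements: weights add. Integer weights allow
inverses, which the argument needs. -/
theorem twisted_mul (i j : ℤ) (x y : F) :
    twisted D e (i + j) (x * y) = twisted D e i x * y + x * twisted D e j y := by
  simp only [twisted, D.leibniz, smul_eq_mul]
  push_cast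
  ring

theorem twisted_zpow (i n : ℤ) {x : F} (hx : x ≠ 0) :
    twisted D e (n * i) (x ^ n) = n * x ^ (n - 1) * twisted D e i x := by
  simp only [twisted, D.leibniz_zpow, smul_eq_mul, zsmul_eq_mul]
  rw [show x ^ n = x ^ (n - 1) * x by rw [zpow_sub_one₀ hx]; field_simp]
  push_cast
  ring

theorem twisted_sub (i : ℤ) (x y : F) :
    twisted D e i (x - y) = twisted D e i x - twisted D e i y := by
  simp only [twisted, map_sub]
  ring

variable {D e}

theorem twisted_mul_eq_zero {i j : ℤ} {x y : F} (hx : twisted D e i x = 0)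
    (hy : twisted D e j y = 0) : twisted D e (i + j) (x * y) = 0 := by
  rw [twisted_mul, hx, hy]
  simp

theorem twisted_zpow_eq_zero {i : ℤ} {x : F} (hx : twisted D e i x = 0) (hx0 : x ≠ 0) (n : ℤ) :
    twisted D e (n * i) (x ^ n) = 0 := by
  rw [twisted_zpow D e i n hx0, hx, mul_zero]

theorem twistedIter_sub (d : ℤ) (n : ℕ) (i : ℤ) (x y : F) :
    twistedIter D e d n i (x - y) = twistedIter D e d n i x - twistedIter D e d n i y := by
  induction n generalizing i x y with
  | zero => rfl
  | succ n ih => simp only [twistedIter, twisted_sub, ih]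

theorem twistedIter_succ' (d : ℤ) (n : ℕ) (i : ℤ) (x : F) :
    twistedIter D e d (n + 1) i x = twisted D e (i + n * d) (twistedIter D e d n i x) := by
  induction n generalizing i x with
  | zero => simp [twistedIter]
  | succ n ih =>
    rw [twistedIter, ih, twistedIter]
    congr 1
    push_cast
    ring

variable {d q : ℤ} {r : F}

theorem twistedIter_mul_pow (hr : twisted D e q r ≠ 0)
    (hr2 : twisted D e (q + d) (twisted D e q r) = 0) (n : ℕ) {i : ℤ} {κ : F}
    (hκ : twisted D e (i - n * q) κ = 0) :
    twistedIter D e d n i (κ * r ^ n) = n.factorial * κ * twisted D e q r ^ n := by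
  have hr0 : r ≠ 0 := by rintro rfl; exact hr (twisted_zero D e q)
  induction n generalizing i κ with
  | zero => simp [twistedIter]
  | succ n ih =>
    have h1 : twisted D e i (κ * r ^ (n + 1)) =
        ((n + 1 : ℕ) : F) * (κ * twisted D e q r) * r ^ n := by
      have := twisted_mul D e (i - (n + 1 : ℕ) * q) ((n + 1 : ℕ) * q) κ (r ^ (n + 1))
      rw [sub_add_cancel, hκ] at this
      rw [this, ← zpow_natCast r (n + 1), twisted_zpow D e q _ hr0]
      rw [show ((n + 1 : ℕ) : ℤ) - 1 = n by simp, zpow_natCast r n]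
      push_cast
      ring
    have h2 : twisted D e (i + d - n * q) (((n + 1 : ℕ) : F) * (κ * twisted D e q r)) = 0 := by
      have h3 := twisted_mul_eq_zero hκ hr2
      have h4 : twisted D e 0 ((n + 1 : ℕ) : F) = 0 := by rw [twisted_zero_left, D.map_natCast]
      convert! twisted_mul_eq_zero h4 h3 using 2
      push_cast
      ring
    rw [twistedIter, h1, ih h2, Nat.factorial_succ]
    push_cast
    ring

variable [CharZero F]

/-- Graded Taylor expansion: `r` has weight `q`, so the coefficient of `r ^ j` in an element of
weight `i` is a kernel element of weight `i - j * q`. Over a field one may divide by the derivative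
of `r`. -/
theorem mem_closure_of_twistedIter_eq_zero (hr : twisted D e q r ≠ 0)
    (hr2 : twisted D e (q + d) (twisted D e q r) = 0) (n : ℕ) {i : ℤ} {c : F}
    (hc : twistedIter D e d n i c = 0) :
    c ∈ AddSubgroup.closure {x | ∃ (j : ℕ) (κ : F), twisted D e (i - j * q) κ = 0 ∧
      x = κ * r ^ j} := by
  induction n generalizing c with
  | zero =>
    obtain rfl : c = 0 := hc
    exact zero_mem _
  | succ n ih =>
    rw [twistedIter_succ'] at hc
    set w := twistedIter D e d n i c with hw
    have h0 : (n.factorial : F) ≠ 0 := by exact_mod_cast n.factorial_ne_zero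
    have hκ : twisted D e (i - n * q)
        ((n.factorial : F)⁻¹ * (w * twisted D e q r ^ (-n : ℤ))) = 0 := by
      have h4 : twisted D e 0 (n.factorial : F)⁻¹ = 0 := by
        rw [twisted_zero_left, D.leibniz_inv, D.map_natCast, smul_zero]
      convert! twisted_mul_eq_zero h4 (twisted_mul_eq_zero hc (twisted_zpow_eq_zero hr2 hr (-n)))
        using 2
      ring
    have h5 := twistedIter_mul_pow hr hr2 n hκ
    have h6 : twistedIter D e d n i (c - (n.factorial : F)⁻¹ *
        (w * twisted D e q r ^ (-n : ℤ)) * r ^ n) = 0 := by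
      rw [twistedIter_sub, h5, ← hw, zpow_neg, zpow_natCast]
      field_simp
      ring
    have h7 := add_mem (ih h6) (AddSubgroup.subset_closure ⟨n, _, hκ, rfl⟩)
    rwa [sub_add_cancel] at h7

/-- Each generator of `F` is a sum of terms `κ * r ^ j` with `κ` in the kernel, of weight `-(j *
q)`. The exponents `j` for which a nonzero such `κ` exists form a group `bℤ`, nonzero because of
`a`. With `ρ` such a kernel element for `b` and `j = b * l`, one has `κ * r ^ j = (κ * ρ⁻ˡ) * (ρ * r
^ b) ^ l`, whose first factor is a constant of weight zero. So `t = ρ * r ^ b`. -/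
theorem exists_adjoin_constField_eq_top (hD : D ≠ 0) {m : ℤ} (hm : m ≠ 0) {a : F} (ha0 : a ≠ 0)
    (ha : twisted D e m a = 0) {T : Set F} (hT : IntermediateField.adjoin k T = ⊤)
    (hnil : ∀ c ∈ T, ∃ n, twistedIter D e d n 0 c = 0) :
    ∃ t, D t ≠ 0 ∧ IntermediateField.adjoin D.constField {t} = ⊤ := by
  obtain ⟨c₀, hc₀T, hc₀⟩ : ∃ c ∈ T, D c ≠ 0 := by
    by_contra! h
    have h1 : IntermediateField.adjoin k T ≤ D.constField :=
      IntermediateField.adjoin_le_iff.mpr fun c hc => h c hc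
    rw [hT] at h1
    exact hD (Derivation.ext fun x => h1 (IntermediateField.mem_top (x := x)))
  obtain ⟨n, hn1, hn2⟩ := exists_last_ne_zero (u := fun n => twistedIter D e d (n + 1) 0 c₀)
    (by simpa [twistedIter, twisted_zero_left] using hc₀) (by
      obtain ⟨n, hn⟩ := hnil c₀ hc₀T
      exact ⟨n, by rw [twistedIter_succ', hn, twisted_zero]⟩)
  -- A homogeneous local slice: the last iterate of `c₀` but one before vanishing. Each iteration
  -- raises the weight by `d`.
  obtain ⟨q, r, hr, hr2⟩ : ∃ q r, twisted D e q r ≠ 0 ∧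
      twisted D e (q + d) (twisted D e q r) = 0 := by
    refine ⟨0 + n * d, twistedIter D e d n 0 c₀, ?_, ?_⟩
    · rwa [← twistedIter_succ']
    · rw [← twistedIter_succ']
      rw [twistedIter_succ'] at hn2
      convert hn2 using 2
      push_cast
      ring
  have hr0 : r ≠ 0 := by rintro rfl; exact hr (twisted_zero D e q)
  let H : AddSubgroup ℤ :=
    { carrier := {j | ∃ κ, κ ≠ 0 ∧ twisted D e (-(j * q)) κ = 0}
      zero_mem' := ⟨1, one_ne_zero, by simp [twisted]⟩
      add_mem' := by
        rintro i j ⟨x, hx0, hx⟩ ⟨y, hy0, hy⟩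
        refine ⟨x * y, mul_ne_zero hx0 hy0, ?_⟩
        convert twisted_mul_eq_zero hx hy using 2
        ring
      neg_mem' := by
        rintro i ⟨x, hx0, hx⟩
        refine ⟨x ^ (-1 : ℤ), zpow_ne_zero _ hx0, ?_⟩
        convert twisted_zpow_eq_zero hx hx0 (-1) using 2
        ring }
  have hmH : m ∈ H := by
    refine ⟨a ^ (-q), zpow_ne_zero _ ha0, ?_⟩
    convert twisted_zpow_eq_zero ha ha0 (-q) using 2
    ring
  obtain ⟨b, hb⟩ := Int.subgroup_cyclic H
  have hbH : b ∈ H := hb ▸ AddSubgroup.subset_closure (Set.mem_singleton b)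
  have hb0 : b ≠ 0 := by
    rintro rfl
    rw [hb, AddSubgroup.mem_closure_singleton] at hmH
    obtain ⟨l, hl⟩ := hmH
    exact hm (by simpa using hl.symm)
  obtain ⟨ρ, hρ0, hρ⟩ := hbH
  refine ⟨ρ * r ^ b, ?_, ?_⟩
  · have h1 := twisted_mul D e (-(b * q)) (b * q) ρ (r ^ b)
    rw [neg_add_cancel, twisted_zero_left, hρ, twisted_zpow D e q b hr0] at h1
    rw [h1, zero_mul, zero_add]
    have : (b : F) ≠ 0 := by exact_mod_cast hb0
    exact mul_ne_zero hρ0 (mul_ne_zero (mul_ne_zero this (zpow_ne_zero _ hr0)) hr)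
  · set E := IntermediateField.adjoin D.constField {ρ * r ^ b}
    have htE : ρ * r ^ b ∈ E := IntermediateField.mem_adjoin_simple_self _ _
    have hTE : T ⊆ E := by
      intro c hc
      obtain ⟨N, hN⟩ := hnil c hc
      refine (AddSubgroup.closure_le E.toSubring.toAddSubgroup).mpr ?_
        (mem_closure_of_twistedIter_eq_zero hr hr2 N hN)
      rintro _ ⟨j, κ, hκ, rfl⟩
      change κ * r ^ j ∈ E
      by_cases hκ0 : κ = 0
      · rw [hκ0, zero_mul]
        exact zero_mem E
      have hjH : (j : ℤ) ∈ H := ⟨κ, hκ0, by simpa using hκ⟩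
      rw [hb, AddSubgroup.mem_closure_singleton] at hjH
      obtain ⟨l, hl⟩ := hjH
      rw [smul_eq_mul] at hl
      have hK : D (κ * ρ ^ (-l)) = 0 := by
        rw [← twisted_zero_left D e]
        convert twisted_mul_eq_zero hκ (twisted_zpow_eq_zero hρ hρ0 (-l)) using 2
        rw [← hl]
        ring
      have h1 : κ * r ^ j = κ * ρ ^ (-l) * (ρ * r ^ b) ^ l := by
        rw [← zpow_natCast, ← hl, mul_zpow, ← zpow_mul, zpow_neg, mul_comm b l]
        field_simp
      rw [h1]
      exact mul_mem (E.algebraMap_mem (⟨_, hK⟩ : D.constField)) (zpow_mem htE l)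
    have h2 : IntermediateField.adjoin k T ≤ E.restrictScalars k :=
      IntermediateField.adjoin_le_iff.mpr hTE
    rw [hT] at h2
    exact eq_top_iff.mpr fun x _ => h2 (IntermediateField.mem_top (x := x))

end Twisted

/-! ### Leading coefficients with respect to a transcendental element -/

section Lead

open Polynomial

variable {k L : Type*} [Field k] [Field L] [Algebra k L]

/-- `x = P(s)` for a polynomial `P` over `F` of degree at most `i` with `i`-th coefficient `c`. -/
def HasLead (F : IntermediateField k L) (s : L) (i : ℕ) (x : L) (c : F) : Prop :=
  ∃ P : F[X], P.natDegree ≤ i ∧ P.coeff i = c ∧ aeval s P = x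

variable {F : IntermediateField k L} {s : L}

theorem HasLead.add {i : ℕ} {x y : L} {a b : F} (hx : HasLead F s i x a) (hy : HasLead F s i y b) :
    HasLead F s i (x + y) (a + b) := by
  obtain ⟨P, hP, rfl, rfl⟩ := hx
  obtain ⟨Q, hQ, rfl, rfl⟩ := hy
  exact ⟨P + Q, natDegree_add_le_of_degree_le hP hQ, coeff_add P Q i, map_add _ _ _⟩

theorem HasLead.mul {i j : ℕ} {x y : L} {a b : F} (hx : HasLead F s i x a)
    (hy : HasLead F s j y b) : HasLead F s (i + j) (x * y) (a * b) := by
  obtain ⟨P, hP, rfl, rfl⟩ := hx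
  obtain ⟨Q, hQ, rfl, rfl⟩ := hy
  exact ⟨P * Q, natDegree_mul_le_of_le hP hQ, coeff_mul_add_eq_of_natDegree_le hP hQ, map_mul _ _ _⟩

theorem hasLead_coe (c : F) : HasLead F s 0 (c : L) c := ⟨C c, by simp, by simp, by simp⟩

theorem hasLead_self : HasLead F s 1 s 1 := ⟨X, by simp, by simp, by simp⟩

theorem HasLead.of_lt {i j : ℕ} (h : i < j) {x : L} {a : F} (hx : HasLead F s i x a) :
    HasLead F s j x 0 := by
  obtain ⟨P, hP, rfl, rfl⟩ := hx
  exact ⟨P, hP.trans h.le, coeff_eq_zero_of_natDegree_lt (hP.trans_lt h), rfl⟩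

theorem HasLead.eq_zero (hs : Transcendental F s) {i : ℕ} {a : F} (h : HasLead F s i 0 a) :
    a = 0 := by
  obtain ⟨P, hP, rfl, h0⟩ := h
  rw [transcendental_iff.mp hs P h0, coeff_zero]

/-- The coefficient of `s ^ (i + d)` in `E (a * s ^ i)` is `δ a + i * e * a`; lower terms of `x`
stay in lower degree, as `E` raises degrees by at most `d`. -/
theorem HasLead.apply_derivation {E : Derivation k L L} {δ : Derivation k F F} {e : F} {d : ℕ}
    (hF : ∀ c : F, HasLead F s d (E c) (δ c)) (he : HasLead F s (d + 1) (E s) e) {i : ℕ} {x : L}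
    {a : F} (hx : HasLead F s i x a) : HasLead F s (i + d) (E x) (twisted δ e i a) := by
  induction i generalizing x a with
  | zero =>
    obtain ⟨P, hP, rfl, rfl⟩ := hx
    rw [eq_C_of_natDegree_le_zero hP, aeval_C]
    simpa [twisted] using hF (P.coeff 0)
  | succ i ih =>
    obtain ⟨P, hP, rfl, rfl⟩ := hx
    have hy : HasLead F s i (aeval s P.divX) (P.coeff (i + 1)) :=
      ⟨P.divX, by rw [natDegree_divX_eq_natDegree_tsub_one]; omega, coeff_divX, rfl⟩
    have hx : aeval s P = aeval s P.divX * s + (P.coeff 0 : F) := by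
      conv_lhs => rw [← divX_mul_X_add P]
      simp
    have h1 : HasLead F s (i + d + 1) (E (aeval s P.divX) * s) (twisted δ e i (P.coeff (i + 1)) * 1) :=
      (ih hy).mul hasLead_self
    have h2 : HasLead F s (i + (d + 1)) (aeval s P.divX * E s) (P.coeff (i + 1) * e) := hy.mul he
    have h3 : HasLead F s (i + d + 1) (E (P.coeff 0 : F)) 0 := (hF _).of_lt (by omega)
    have h4 := (h1.add h2).add h3
    convert! h4 using 1
    · omega
    · rw [hx, map_add, E.leibniz]
      simp only [smul_eq_mul]
      ring
    · simp only [twisted]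
      push_cast
      ring

theorem HasLead.iterate_derivation {E : Derivation k L L} {δ : Derivation k F F} {e : F} {d : ℕ}
    (hF : ∀ c : F, HasLead F s d (E c) (δ c)) (he : HasLead F s (d + 1) (E s) e) (n : ℕ) {i : ℕ}
    {x : L} {a : F} (hx : HasLead F s i x a) :
    HasLead F s (i + n * d) (E^[n] x) (twistedIter δ e d n i a) := by
  induction n generalizing i x a with
  | zero => simpa [twistedIter] using hx
  | succ n ih =>
    have h := ih (HasLead.apply_derivation hF he hx)
    rw [Function.iterate_succ_apply, twistedIter]
    convert! h using 1
    ring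

/-- A derivation of `F` whose values are the coefficients of degree `d` of those of `E`. -/
theorem exists_derivation_hasLead (hs : Transcendental F s) (E : Derivation k L L) {d : ℕ}
    (h : ∀ c : F, ∃ a, HasLead F s d (E c) a) :
    ∃ δ : Derivation k F F, ∀ c : F, HasLead F s d (E c) (δ c) := by
  -- A linear left inverse of evaluation at `s`, defined on all of `L`, makes the reading of
  -- coefficients linear.
  obtain ⟨ψ, hψ⟩ := (aeval s : F[X] →ₐ[F] L).toLinearMap.exists_leftInverse_of_injective
    (LinearMap.ker_eq_bot.mpr (transcendental_iff_injective.mp hs))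
  have hψ' (P : F[X]) : ψ (aeval s P) = P := LinearMap.congr_fun hψ P
  let δ₀ : F →ₗ[k] F :=
    (lcoeff F d).restrictScalars k ∘ₗ ψ.restrictScalars k ∘ₗ E.toLinearMap ∘ₗ F.val.toLinearMap
  have hδ₀ (c : F) : δ₀ c = (ψ (E c)).coeff d := rfl
  refine ⟨Derivation.mk' δ₀ fun a b => ?_, fun c => ?_⟩
  · rw [hδ₀, hδ₀, hδ₀]
    have : E ((a * b : F) : L) = a • E (b : L) + b • E (a : L) := E.leibniz (a : L) (b : L)
    rw [this, map_add, map_smul, map_smul, coeff_add, coeff_smul, coeff_smul]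
  · obtain ⟨a, P, hP, rfl, hPc⟩ := h c
    refine ⟨P, hP, ?_, hPc⟩
    change _ = (ψ (E c)).coeff d
    rw [← hPc, hψ']

/-- A bound on the degree of `E` over finitely many generators passes to all of `F`: sums, products
and inverses only multiply the values of `E` by elements of `F`, which have degree zero in `s`. -/
theorem exists_degree_bound {E : Derivation k L L} {T : Finset L}
    (hT : IntermediateField.adjoin k (T : Set L) = F)
    (hET : ∀ c ∈ T, ∃ P : F[X], aeval s P = E c) :
    ∃ N, ∀ c : F, ∃ a, HasLead F s N (E c) a := by
  choose! P hP using hET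
  set N := T.sup fun c => (P c).natDegree
  refine ⟨N, fun c => ?_⟩
  have key : ∀ x ∈ IntermediateField.adjoin k (T : Set L),
      x ∈ F ∧ ∃ Q : F[X], Q.natDegree ≤ N ∧ aeval s Q = E x := by
    intro x hx
    induction hx using IntermediateField.adjoin_induction with
    | mem x hx =>
      exact ⟨hT ▸ IntermediateField.subset_adjoin k _ hx, P x,
        Finset.le_sup (f := fun c => (P c).natDegree) hx, hP x hx⟩
    | algebraMap x => exact ⟨F.algebraMap_mem x, 0, by simp, by simp⟩
    | add x y hx hy ihx ihy =>
      obtain ⟨hx, Q, hQ, hQx⟩ := ihx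
      obtain ⟨hy, R, hR, hRy⟩ := ihy
      exact ⟨add_mem hx hy, Q + R, natDegree_add_le_of_degree_le hQ hR, by simp [hQx, hRy]⟩
    | inv x hx ihx =>
      obtain ⟨hx, Q, hQ, hQx⟩ := ihx
      refine ⟨inv_mem hx, (-(⟨x, hx⟩ : F)⁻¹ ^ 2) • Q, (natDegree_smul_le _ _).trans hQ, ?_⟩
      rw [map_smul, hQx, E.leibniz_inv]
      rfl
    | mul x y hx hy ihx ihy =>
      obtain ⟨hx, Q, hQ, hQx⟩ := ihx
      obtain ⟨hy, R, hR, hRy⟩ := ihy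
      refine ⟨mul_mem hx hy, (⟨x, hx⟩ : F) • R + (⟨y, hy⟩ : F) • Q,
        natDegree_add_le_of_degree_le ((natDegree_smul_le _ _).trans hR)
          ((natDegree_smul_le _ _).trans hQ), ?_⟩
      rw [map_add, map_smul, map_smul, hQx, hRy, E.leibniz]
      rfl
  obtain ⟨-, Q, hQ, hQc⟩ := key c (hT ▸ c.2)
  exact ⟨_, Q, hQ, rfl, hQc⟩

end Lead

/-! ### From a derivation of `F(s)` to `L = K(s, t)` -/

section Rational

open Polynomial

variable {k L : Type*} [Field k] [Field L] [Algebra k L]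

theorem isRationalFunctionField_two {K : IntermediateField k L} {x y : L}
    (h : AlgebraicIndependent K ![x, y]) (htop : IntermediateField.adjoin K {x, y} = ⊤) :
    IsRationalFunctionField K L 2 := by
  have h1 : IntermediateField.adjoin K (Set.range ![x, y]) = ⊤ := by
    rw [← htop]
    congr 1
    simp [Matrix.range_cons, Set.pair_comm]
  exact ⟨h.aevalEquivField.trans
    ((IntermediateField.equivOfEq h1).trans IntermediateField.topEquiv)⟩

/-- A field generated by a transcendental element over `F`, where `F` is generated by a
non-constant element over the constants of a derivation. -/
theorem exists_isRationalFunctionField [CharZero L] {F : IntermediateField k L} {s : L}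
    (hs : Transcendental F s) (htop : IntermediateField.adjoin F {s} = ⊤) {δ : Derivation k F F}
    {t : F} (ht : δ t ≠ 0) (hFt : IntermediateField.adjoin δ.constField {t} = ⊤) :
    ∃ K : IntermediateField k L, IsRationalFunctionField K L 2 := by
  have hKF : IntermediateField.lift δ.constField ≤ F := IntermediateField.lift_le _
  set K := IntermediateField.lift δ.constField with hK
  refine ⟨K, isRationalFunctionField_two (x := s) (y := (t : L)) ?_ ?_⟩
  · let : Algebra K F := (IntermediateField.inclusion hKF).toAlgebra
    have : IsScalarTower K F L := IsScalarTower.of_algebraMap_eq fun _ => rfl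
    have hconst (a : K) : δ (algebraMap K F a) = 0 := by
      obtain ⟨b, hb, hba⟩ := a.2
      have : algebraMap K F a = b := Subtype.ext hba.symm
      rw [this]
      exact hb
    have : FaithfulSMul K F := (faithfulSMul_iff_algebraMap_injective K F).mpr
      (IntermediateField.inclusion_injective hKF)
    have htK : Transcendental K t := fun h =>
      ht ((δ.changeBase hconst).apply_eq_zero_of_isAlgebraic h)
    have h1 := AlgebraicIndependent.sumElim_comp
      (algebraicIndependent_iff_transcendental.mpr htK)
      (algebraicIndependent_iff_transcendental.mpr hs)
    have h2 := h1.comp (finSumFinEquiv (m := 1) (n := 1)).symm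
      (finSumFinEquiv (m := 1) (n := 1)).symm.injective
    convert! h2 using 1
    ext i
    fin_cases i <;> rfl
  · set M := IntermediateField.adjoin K {s, (t : L)}
    have hsM : s ∈ M := IntermediateField.subset_adjoin K _ (by simp)
    have htM : (t : L) ∈ M := IntermediateField.subset_adjoin K _ (by simp)
    have hF (x : F) : (x : L) ∈ M := by
      have hx : x ∈ IntermediateField.adjoin δ.constField {t} := hFt ▸ IntermediateField.mem_top
      induction hx using IntermediateField.adjoin_induction with
      | mem x hx => rwa [Set.mem_singleton_iff.mp hx]
      | algebraMap a => exact M.algebraMap_mem ⟨_, a, a.2, rfl⟩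
      | add x y _ _ hx hy => exact add_mem hx hy
      | inv x _ hx => exact inv_mem hx
      | mul x y _ _ hx hy => exact mul_mem hx hy
    refine eq_top_iff.mpr fun x _ => ?_
    have hx : x ∈ IntermediateField.adjoin F {s} := htop ▸ IntermediateField.mem_top
    induction hx using IntermediateField.adjoin_induction with
    | mem x hx => rwa [Set.mem_singleton_iff.mp hx]
    | algebraMap a => exact hF a
    | add x y _ _ hx hy => exact add_mem (hx trivial) (hy trivial)
    | inv x _ hx => exact inv_mem (hx trivial)
    | mul x y _ _ hx hy => exact mul_mem (hx trivial) (hy trivial)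

/-- Take `d` least such that `E` raises degrees in `s` by at most `d`; the resulting `δ` and `e`
satisfy the hypotheses of `exists_adjoin_constField_eq_top`, the leading coefficient of `f` being
the kernel element of nonzero weight. -/
theorem exists_isRationalFunctionField_of_derivation [CharZero L] {F : IntermediateField k L}
    {s : L} (hs : Transcendental F s) (htop : IntermediateField.adjoin F {s} = ⊤)
    {E : Derivation k L L} (hE : E ≠ 0) {T : Finset L}
    (hT : IntermediateField.adjoin k (T : Set L) = F)
    (hET : ∀ c ∈ T, ∃ P : F[X], aeval s P = E c) (hEs : ∃ P : F[X], aeval s P = E s)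
    (hnil : ∀ c ∈ T, ∃ n, E^[n] c = 0) {f : F[X]} (hf : f.natDegree ≠ 0)
    (hEf : E (aeval s f) = 0) :
    ∃ K : IntermediateField k L, IsRationalFunctionField K L 2 := by
  classical
  have hTF {c : L} (hc : c ∈ T) : c ∈ F := hT ▸ IntermediateField.subset_adjoin k _ hc
  have hex : ∃ d, (∀ c : F, ∃ a, HasLead F s d (E c) a) ∧ ∃ e, HasLead F s (d + 1) (E s) e := by
    obtain ⟨N, hN⟩ := exists_degree_bound hT hET
    obtain ⟨P, hP⟩ := hEs
    refine ⟨N + P.natDegree + 1, fun c => ?_, _, P, by omega, rfl, hP⟩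
    obtain ⟨a, ha⟩ := hN c
    exact ⟨0, ha.of_lt (by omega)⟩
  set d := Nat.find hex with hd
  obtain ⟨hdF, e, he⟩ := Nat.find_spec hex
  rw [← hd] at hdF he
  obtain ⟨δ, hδ⟩ := exists_derivation_hasLead hs E hdF
  have hlead : HasLead F s f.natDegree (aeval s f) f.leadingCoeff := ⟨f, le_rfl, rfl, rfl⟩
  have hlc : f.leadingCoeff ≠ 0 := by
    rw [Ne, leadingCoeff_eq_zero]
    rintro rfl
    simp at hf
  have hker : twisted δ e f.natDegree f.leadingCoeff = 0 := by
    have h := HasLead.apply_derivation hδ he hlead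
    rw [hEf] at h
    exact h.eq_zero hs
  -- If `δ = 0`, the kernel relation reads `deg f * e * lc(f) = 0`, so `e = 0` too and the degree of
  -- `E` is less than `d`.
  have hδ0 : δ ≠ 0 := by
    rintro rfl
    have he0 : e = 0 := by
      simpa [twisted, hf, hlc, leadingCoeff_eq_zero] using hker
    subst he0
    have hlower {i : ℕ} {x : L} (h : HasLead F s (i + 1) x 0) : ∃ a, HasLead F s i x a := by
      obtain ⟨P, hP, hP0, rfl⟩ := h
      refine ⟨_, P, ?_, rfl, rfl⟩
      exact natDegree_le_pred hP hP0
    obtain ⟨d', hd'⟩ | hd0 : (∃ d', d = d' + 1) ∨ d = 0 := by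
      rcases d with _ | d'
      · exact Or.inr rfl
      · exact Or.inl ⟨d', rfl⟩
    · rw [hd'] at hδ he
      exact Nat.find_min hex (show d' < Nat.find hex by omega)
        ⟨fun c => hlower (by simpa using hδ c), hlower he⟩
    -- Here `E` would have degree `-1`, which a natural `d` cannot record: `E` kills `F`, and `0 =
    -- f'(s) * E s` then gives `E = 0`.
    · have hEF (c : F) : E (algebraMap F L c) = 0 := by
        obtain ⟨P, hP, hP0, hPc⟩ := hδ c
        rw [hd0] at hP hP0
        change E c = 0
        rw [← hPc, eq_C_of_natDegree_le_zero hP, hP0]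
        simp
      have h1 := (E.changeBase hEF).map_aeval f s
      rw [Derivation.changeBase_apply, hEf, Derivation.changeBase_apply, eq_comm, smul_eq_zero]
        at h1
      have hEs0 : E s = 0 := h1.resolve_left fun h =>
        hf (derivative_eq_zero.mp (transcendental_iff.mp hs _ h))
      refine hE (Derivation.ext fun x => ?_)
      have hx : x ∈ IntermediateField.adjoin F {s} := htop ▸ IntermediateField.mem_top
      have hle : IntermediateField.adjoin F {s} ≤ (E.changeBase hEF).constField :=
        IntermediateField.adjoin_le_iff.mpr (Set.singleton_subset_iff.mpr hEs0)
      exact hle hx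
  obtain ⟨t, ht, htop'⟩ := exists_adjoin_constField_eq_top (e := e) (d := d) hδ0
    (m := f.natDegree) (by exact_mod_cast hf) hlc hker (T := {c : F | (c : L) ∈ T}) (by
      refine eq_top_iff.mpr fun x _ => ?_
      have hx : (x : L) ∈ IntermediateField.adjoin k (T : Set L) := hT ▸ x.2
      have h1 : IntermediateField.adjoin k (T : Set L) ≤
          IntermediateField.lift (IntermediateField.adjoin k {c : F | (c : L) ∈ T}) :=
        IntermediateField.adjoin_le_iff.mpr fun c hc =>
          ⟨⟨c, hTF hc⟩, IntermediateField.subset_adjoin k _ hc, rfl⟩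
      obtain ⟨y, hy, hyx⟩ := h1 hx
      rwa [← Subtype.ext (a1 := y) (a2 := x) hyx]) fun c hc => by
      obtain ⟨n, hn⟩ := hnil c hc
      refine ⟨n, ?_⟩
      have h := HasLead.iterate_derivation hδ he n (hasLead_coe c)
      rw [hn] at h
      simpa using h.eq_zero hs
  exact exists_isRationalFunctionField hs htop ht htop'

end Rational

/-! ### Derivations of a domain and of its field of fractions -/

section Extend

variable {k R L : Type*} [CommRing k] [CommRing R] [Field L] [Algebra k R] [Algebra k L]
  [Algebra R L] [IsScalarTower k R L] [IsFractionRing R L]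

/-- A derivation is a ring map `x ↦ x + ε D x` into dual numbers. There units are detected modulo
`ε`, so the map extends to fractions. -/
theorem Derivation.exists_extend_fractionRing [IsDomain R] (D : Derivation k R R) :
    ∃ E : Derivation k L L, ∀ x, E (algebraMap R L x) = algebraMap R L (D x) := by
  let v (x : R) : TrivSqZeroExt L L := (algebraMap R L x, algebraMap R L (D x))
  have hv₁ (x : R) : (v x).fst = algebraMap R L x := rfl
  have hv₂ (x : R) : (v x).snd = algebraMap R L (D x) := rfl
  let φ : R →+* TrivSqZeroExt L L :=
    { toFun := v
      map_one' := by ext <;> simp [hv₁, hv₂]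
      map_mul' := fun x y => by ext <;> simp [hv₁, hv₂, D.leibniz, mul_comm]
      map_zero' := by ext <;> simp [hv₁, hv₂]
      map_add' := fun x y => by ext <;> simp [hv₁, hv₂] }
  have hφ (x : R) : φ x = v x := rfl
  have hunit (y : nonZeroDivisors R) : IsUnit (φ y) := by
    rw [TrivSqZeroExt.isUnit_iff_isUnit_fst, hφ, hv₁]
    simp
  let ψ : L →+* TrivSqZeroExt L L := IsLocalization.lift hunit
  have hψ (x : R) : ψ (algebraMap R L x) = φ x := IsLocalization.lift_eq hunit x
  have hfst (x : L) : (ψ x).fst = x := by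
    have : ((TrivSqZeroExt.fstHom L L L).toRingHom.comp ψ) = RingHom.id L :=
      IsLocalization.ringHom_ext (nonZeroDivisors R) (by
        ext x
        simp [hψ, hφ, hv₁])
    exact RingHom.congr_fun this x
  have hmul (x y : L) : (ψ (x * y)).snd = x * (ψ y).snd + y * (ψ x).snd := by
    rw [map_mul, TrivSqZeroExt.snd_mul, hfst, hfst]
    simp [mul_comm]
  have hk (c : k) : (ψ (algebraMap k L c)).snd = 0 := by
    rw [IsScalarTower.algebraMap_apply k R L, hψ, hφ, hv₂]
    simp
  refine ⟨Derivation.mk'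
    { toFun := fun x => (ψ x).snd
      map_add' := fun x y => by simp
      map_smul' := fun c x => by
        rw [Algebra.smul_def, hmul, hk, mul_zero, add_zero, RingHom.id_apply, Algebra.smul_def] }
    hmul, fun x => ?_⟩
  change (ψ (algebraMap R L x)).snd = _
  rw [hψ, hφ, hv₂]

end Extend

/-! ### Affine subalgebras of `L` with locally nilpotent derivations -/

section Field

open Polynomial

variable {k L : Type*} [Field k] [Field L] [Algebra k L] {B : Subalgebra k L}

theorem iterate_extend {D : Derivation ℤ B B} {E : Derivation k L L} (hE : ∀ x : B, E x = D x)
    (n : ℕ) (x : B) : E^[n] (x : L) = (D^[n] x : B) := by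
  induction n generalizing x with
  | zero => rfl
  | succ n ih => rw [Function.iterate_succ_apply, hE, ih, Function.iterate_succ_apply]

theorem adjoin_eq_top_of_isFractionRing [IsFractionRing B L] {S : Set L}
    (hS : Algebra.adjoin k S = B) {M : IntermediateField k L} (hM : S ⊆ M) : M = ⊤ := by
  refine eq_top_iff.mpr fun x _ => ?_
  have hB : B ≤ M.toSubalgebra := hS ▸ Algebra.adjoin_le hM
  obtain ⟨a, b, -, rfl⟩ := IsFractionRing.div_surjective (A := B) x
  exact div_mem (hB a.2) (hB b.2)

variable [CharZero L]

theorem apply_algebraMap_eq_zero {D : Derivation ℤ B B} (hD : D ∈ LND B) (c : k) :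
    D (algebraMap k B c) = 0 := by
  by_cases hc : c = 0
  · simp [hc]
  · exact apply_eq_zero_of_isUnit hD ((IsUnit.mk0 c hc).map (algebraMap k B))

theorem exists_extend [IsFractionRing B L] {D : Derivation ℤ B B} (hD : D ∈ LND B) :
    ∃ E : Derivation k L L, ∀ x : B, E x = D x := by
  obtain ⟨E, hE⟩ := (D.changeBase (apply_algebraMap_eq_zero hD)).exists_extend_fractionRing (L := L)
  exact ⟨E, hE⟩

/-- A finitely generated domain with a nonzero locally nilpotent derivation: its field of fractions
is generated by a local slice over the constants, which are generated by elements of the kernel. -/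
theorem exists_generators_of_slice [IsFractionRing B L] (hB : B.FG) {D : Derivation ℤ B B}
    (hD : D ∈ LND B) {E : Derivation k L L} (hE : ∀ x : B, E x = D x) {r : B} (hr : D r ≠ 0)
    (hr2 : D (D r) = 0) :
    (∀ b : B, ∃ P : E.constField[X], aeval (r : L) P = b) ∧
    IntermediateField.adjoin E.constField {(r : L)} = ⊤ ∧
    ∃ T : Finset L, IntermediateField.adjoin k (T : Set L) = E.constField ∧
      ∀ c ∈ T, ∃ a : B, D a = 0 ∧ (a : L) = c := by
  classical
  obtain ⟨S, hS⟩ := hB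
  have hrt : Transcendental E.constField (r : L) :=
    Derivation.transcendental_constField (by rw [hE]; exact_mod_cast hr)
  have hconst (a : derivationKer D) : ((a : B) : L) ∈ E.constField := by
    change E ((a : B) : L) = 0
    rw [hE, show D (a : B) = 0 from a.2]
    rfl
  let ι : derivationKer D →+* E.constField :=
    (B.val.toRingHom.comp (derivationKer D).subtype).codRestrict E.constField hconst
  have hslice (b : B) : ∃ u : derivationKer D, u ≠ 0 ∧ ∃ P : (derivationKer D)[X],
      (((u : B) : L) * b) = aeval (r : L) (P.map ι) := by
    obtain ⟨u, hu0, hDu, P, hP⟩ := exists_mul_eq_aeval_slice hr hr2 (hD b)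
    refine ⟨⟨u, hDu⟩, fun h => hu0 (congrArg Subtype.val h), P, ?_⟩
    have h1 := congrArg (B.val) hP
    rw [map_mul, aeval_def, ← AlgHom.coe_toRingHom, hom_eval₂] at h1
    rw [aeval_def, eval₂_map]
    exact h1
  choose u hu0 P hP using hslice
  have hu0' (b : B) : ((u b : B) : L) ≠ 0 := fun h => hu0 b (Subtype.ext (Subtype.ext h))
  -- The denominators and coefficients in the slice expansions of the generators of `B`.
  set T : Finset L :=
    (S.attach.image fun b : S => ((u ⟨b, hS ▸ Algebra.subset_adjoin b.2⟩ : B) : L)) ∪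
      S.attach.biUnion fun b : S =>
        (P ⟨b, hS ▸ Algebra.subset_adjoin b.2⟩).coeffs.image
          fun a : derivationKer D => ((a : B) : L) with hTdef
  have hTker (c : L) (hc : c ∈ T) : ∃ a : B, D a = 0 ∧ (a : L) = c := by
    rw [hTdef, Finset.mem_union, Finset.mem_image, Finset.mem_biUnion] at hc
    rcases hc with ⟨b, -, rfl⟩ | ⟨b, -, hc⟩
    · exact ⟨_, (u _).2, rfl⟩
    · obtain ⟨a, -, rfl⟩ := Finset.mem_image.mp hc
      exact ⟨_, a.2, rfl⟩
  set F₀ := IntermediateField.adjoin k (T : Set L)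
  have hF₀ : F₀ ≤ E.constField := IntermediateField.adjoin_le_iff.mpr fun c hc => by
    obtain ⟨a, ha, rfl⟩ := hTker c hc
    exact hconst ⟨a, ha⟩
  have hF₀r : IntermediateField.adjoin F₀ {(r : L)} = ⊤ := by
    have := adjoin_eq_top_of_isFractionRing hS
      (M := (IntermediateField.adjoin F₀ {(r : L)}).restrictScalars k) (fun b hb => ?_)
    · exact eq_top_iff.mpr fun x _ => by
        have hx : x ∈ (IntermediateField.adjoin F₀ {(r : L)}).restrictScalars k :=
          this ▸ IntermediateField.mem_top
        exact hx
    · set b' : B := ⟨b, hS ▸ Algebra.subset_adjoin hb⟩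
      have hmem (c : L) (hc : c ∈ T) : c ∈ IntermediateField.adjoin F₀ {(r : L)} :=
        (IntermediateField.adjoin F₀ {(r : L)}).algebraMap_mem
          (⟨c, IntermediateField.subset_adjoin k _ hc⟩ : F₀)
      have hu : ((u b' : B) : L) ∈ IntermediateField.adjoin F₀ {(r : L)} :=
        hmem _ (Finset.mem_union_left _ (Finset.mem_image.mpr ⟨⟨b, hb⟩, Finset.mem_attach _ _, rfl⟩))
      have hPb : aeval (r : L) ((P b').map ι) ∈ IntermediateField.adjoin F₀ {(r : L)} := by
        rw [aeval_def, eval₂_map, eval₂_eq_sum, Polynomial.sum]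
        refine sum_mem fun i hi => mul_mem (hmem _ (Finset.mem_union_right _ ?_))
          (pow_mem (IntermediateField.mem_adjoin_simple_self _ _) i)
        exact Finset.mem_biUnion.mpr ⟨⟨b, hb⟩, Finset.mem_attach _ _, Finset.mem_image.mpr
          ⟨_, coeff_mem_coeffs (mem_support_iff.mp hi), rfl⟩⟩
      have hb'' : b = aeval (r : L) ((P b').map ι) / ((u b' : B) : L) := by
        rw [← hP b', mul_div_cancel_left₀ _ (hu0' b')]
      change b ∈ IntermediateField.adjoin F₀ {(r : L)}
      rw [hb'']
      exact div_mem hPb hu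
  refine ⟨fun b => ?_, ?_, T, le_antisymm hF₀ fun c hc => ?_, hTker⟩
  · refine ⟨(ι (u b))⁻¹ • (P b).map ι, ?_⟩
    rw [map_smul, ← hP b]
    change (((u b : B) : L))⁻¹ * (((u b : B) : L) * b) = b
    rw [inv_mul_cancel_left₀ (hu0' b)]
  · refine eq_top_iff.mpr fun x _ => ?_
    have hx : x ∈ IntermediateField.adjoin F₀ {(r : L)} := hF₀r ▸ IntermediateField.mem_top
    induction hx using IntermediateField.adjoin_induction with
    | mem x hx => exact IntermediateField.subset_adjoin _ _ hx
    | algebraMap a =>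
      exact (IntermediateField.adjoin E.constField {(r : L)}).algebraMap_mem ⟨a, hF₀ a.2⟩
    | add x y _ _ hx hy => exact add_mem (hx trivial) (hy trivial)
    | inv x _ hx => exact inv_mem (hx trivial)
    | mul x y _ _ hx hy => exact mul_mem (hx trivial) (hy trivial)
  · have hcr : c ∈ IntermediateField.adjoin F₀ {(r : L)} := hF₀r ▸ IntermediateField.mem_top
    -- A constant `c = U(r) / V(r)` makes `c * V - U` vanish at the transcendental `r`; comparing
    -- coefficients in degree `deg V` puts `c` in `F₀`.
    obtain ⟨U, V, hUV⟩ := (IntermediateField.mem_adjoin_simple_iff F₀ c).mp hcr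
    by_cases hV : aeval (r : L) V = 0
    · rw [hUV, hV, div_zero]
      exact zero_mem _
    let j : F₀ →+* E.constField := (IntermediateField.inclusion hF₀).toRingHom
    have haev (W : F₀[X]) : aeval (r : L) (W.map j) = aeval (r : L) W := by
      rw [aeval_def, eval₂_map, aeval_def]
      rfl
    have hzero : aeval (r : L) (C (⟨c, hc⟩ : E.constField) * V.map j - U.map j) = 0 := by
      rw [map_sub, map_mul, aeval_C, haev, haev]
      change c * _ - _ = 0
      rw [hUV, div_mul_cancel₀ _ hV, sub_self]
    have hpoly := transcendental_iff.mp hrt _ hzero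
    have hV0 : V ≠ 0 := by rintro rfl; simp at hV
    have hcoeff := congrArg (fun p => ((p.coeff V.natDegree : E.constField) : L)) hpoly
    simp only [coeff_sub, coeff_C_mul, coeff_map, coeff_zero] at hcoeff
    have hcoeff' : c * (V.leadingCoeff : L) - (U.coeff V.natDegree : L) = 0 := hcoeff
    have hlc : (V.leadingCoeff : L) ≠ 0 := by
      simpa using hV0
    rw [show c = (U.coeff V.natDegree : L) / (V.leadingCoeff : L) by
      rw [eq_div_iff hlc]; exact sub_eq_zero.mp hcoeff']
    exact div_mem (U.coeff _).2 V.leadingCoeff.2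

/-- Here `F` is the constant field of `E₁`, generated by elements of `ker D₁ ⊆ B`, and `D₂` maps `B`
into `B ⊆ F[r]`. Since `D₁ f ≠ 0`, the polynomial expressing `f` in `r` is nonconstant. -/
theorem exists_isRationalFunctionField_of_lnd [IsFractionRing B L] (hB : B.FG)
    {D₁ D₂ : Derivation ℤ B B} (hD₁ : D₁ ∈ LND B) (hD₂ : D₂ ∈ LND B) (h0 : D₂ ≠ 0) {f : B}
    (hf₁ : D₁ f ≠ 0) (hf₂ : D₂ f = 0) :
    ∃ K : IntermediateField k L, IsRationalFunctionField K L 2 := by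
  obtain ⟨r, hr, hr2⟩ := exists_local_slice hD₁ (by rintro rfl; exact hf₁ rfl)
  obtain ⟨E₁, hE₁⟩ := exists_extend hD₁
  obtain ⟨E₂, hE₂⟩ := exists_extend hD₂
  obtain ⟨hpoly, htop, T, hT, hTker⟩ := exists_generators_of_slice hB hD₁ hE₁ hr hr2
  have hrt : Transcendental E₁.constField (r : L) :=
    Derivation.transcendental_constField (by rw [hE₁]; exact_mod_cast hr)
  obtain ⟨P, hP⟩ := hpoly f
  refine exists_isRationalFunctionField_of_derivation hrt htop (E := E₂) ?_ hT ?_ ?_ ?_ (f := P)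
    ?_ ?_
  · rintro rfl
    exact h0 (Derivation.ext fun x => Subtype.ext (hE₂ x).symm)
  · intro c hc
    obtain ⟨a, -, rfl⟩ := hTker c hc
    rw [hE₂]
    exact hpoly _
  · rw [hE₂]
    exact hpoly _
  · intro c hc
    obtain ⟨a, -, rfl⟩ := hTker c hc
    obtain ⟨n, hn⟩ := hD₂ a
    exact ⟨n, by rw [iterate_extend hE₂, hn]; rfl⟩
  · intro hdeg
    rw [eq_C_of_natDegree_eq_zero hdeg, aeval_C] at hP
    have h1 : E₁ (f : L) = 0 := hP ▸ (P.coeff 0).2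
    rw [hE₁] at h1
    exact hf₁ (Subtype.ext h1)
  · rw [hP, hE₂, hf₂]
    rfl

end Field

/-! ### An affine ring with trivial Makar-Limanov invariant -/

section Construction

open MvPolynomial

theorem map_mem_makarLimanov {R S : Type*} [CommRing R] [CommRing S] (e : R ≃+* S) {x : S}
    (hx : x ∈ makarLimanov S) : e.symm x ∈ makarLimanov R := by
  refine mem_kerInter.mpr fun D hD => ?_
  let D' : Derivation ℤ S S := Derivation.mk'
    (e.toAddMonoidHom.comp (D.toLinearMap.toAddMonoidHom.comp e.symm.toAddMonoidHom)).toIntLinearMap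
    fun a b => by simp [D.leibniz]
  have hD' (a : S) : D' a = e (D (e.symm a)) := rfl
  have hiter (n : ℕ) (a : S) : D'^[n] a = e (D^[n] (e.symm a)) := by
    induction n generalizing a with
    | zero => simp
    | succ n ih => rw [Function.iterate_succ_apply, ih, hD', e.symm_apply_apply,
        ← Function.iterate_succ_apply]
  have h := mem_kerInter.mp hx D' fun a => by
    obtain ⟨n, hn⟩ := hD (e.symm a)
    exact ⟨n, by rw [hiter, hn, map_zero]⟩
  rw [hD'] at h
  simpa using h

/-- A derivation that preserves a subring restricts to it. -/
theorem exists_restrict_derivation {k R S : Type*} [CommRing k] [CommRing R] [CommRing S]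
    [Algebra k S] (j : R →+* S) (hj : Function.Injective j) (d : Derivation k S S)
    (h : ∀ x, ∃ y, j y = d (j x)) : ∃ D : Derivation ℤ R R, ∀ x, j (D x) = d (j x) := by
  choose D hD using h
  exact ⟨Derivation.mk' (AddMonoidHom.toIntLinearMap
    { toFun := D
      map_zero' := hj (by simp [hD])
      map_add' := fun x y => hj (by simp [hD]) }) fun x y => hj (by
        change j (D (x * y)) = j (x * D y + y * D x)
        simp [hD, d.leibniz]), hD⟩

theorem eq_C_of_pderiv_eq_zero {σ R : Type*} [CommRing R] [IsDomain R] [CharZero R]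
    {p : MvPolynomial σ R} (h : ∀ i, pderiv i p = 0) : p = C (constantCoeff p) := by
  classical
  ext m
  rw [coeff_C]
  split_ifs with hm
  · rw [← hm]
    rfl
  · obtain ⟨i, hi⟩ : ∃ i, m i ≠ 0 := by
      by_contra! h
      exact hm (Finsupp.ext fun i => (h i).symm)
    have h1 := coeff_pderiv (i := i) p (m - Finsupp.single i 1)
    rw [h i, coeff_zero, tsub_add_cancel_of_le
      (Finsupp.single_le_iff.mpr (Nat.one_le_iff_ne_zero.mpr hi)), eq_comm, mul_eq_zero] at h1
    exact h1.resolve_right (Nat.cast_add_one_ne_zero _)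

variable {k K : Type*} [Field k] [Field K] [Algebra k K]

/-- The `k`-subalgebra of `K[X₀, X₁]` generated by the `c * Xᵢ` with `c ∈ T`. -/
noncomputable def linearFormsSubalgebra (k : Type*) {K : Type*} [Field k] [Field K] [Algebra k K]
    (T : Set K) :
    Subalgebra k (MvPolynomial (Fin 2) K) :=
  Algebra.adjoin k (Set.image2 (fun c i => C c * X i) T Set.univ)

variable {T : Set K}

theorem fg_linearFormsSubalgebra (hT : T.Finite) : (linearFormsSubalgebra k T).FG :=
  ⟨(hT.image2 _ Set.finite_univ).toFinset, by rw [Set.Finite.coe_toFinset]; rfl⟩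

theorem C_mul_X_mem_linearFormsSubalgebra {c : K} (hc : c ∈ T) (i : Fin 2) :
    C c * X i ∈ linearFormsSubalgebra k T :=
  Algebra.subset_adjoin (Set.mem_image2_of_mem hc (Set.mem_univ i))

theorem constantCoeff_mem_range {p : MvPolynomial (Fin 2) K} (hp : p ∈ linearFormsSubalgebra k T) :
    constantCoeff p ∈ (algebraMap k K).range := by
  induction hp using Algebra.adjoin_induction with
  | mem x hx =>
    obtain ⟨c, -, i, -, rfl⟩ := hx
    simp
  | algebraMap a =>
    rw [IsScalarTower.algebraMap_apply k K (MvPolynomial (Fin 2) K), MvPolynomial.algebraMap_eq,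
      constantCoeff_C]
    exact ⟨a, rfl⟩
  | add x y _ _ hx hy => rw [map_add]; exact add_mem hx hy
  | mul x y _ _ hx hy => rw [map_mul]; exact mul_mem hx hy

/-- `Xᵢ ∂ⱼ` sends the generator `c * Xⱼ` to `c * Xᵢ` and kills the other ones. -/
theorem X_mul_pderiv_mem {i j : Fin 2} {p : MvPolynomial (Fin 2) K}
    (hp : p ∈ linearFormsSubalgebra k T) : X i * pderiv j p ∈ linearFormsSubalgebra k T := by
  induction hp using Algebra.adjoin_induction with
  | mem x hx =>
    obtain ⟨c, hc, l, -, rfl⟩ := hx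
    rw [pderiv_C_mul, pderiv_X]
    by_cases h : l = j
    · subst h
      simpa [mul_comm] using C_mul_X_mem_linearFormsSubalgebra hc i
    · simp [h]
  | algebraMap a =>
    rw [IsScalarTower.algebraMap_apply k K (MvPolynomial (Fin 2) K), MvPolynomial.algebraMap_eq,
      pderiv_C, mul_zero]
    exact zero_mem _
  | add x y _ _ hx hy => rw [map_add, mul_add]; exact add_mem hx hy
  | mul x y hx' hy' hx hy =>
    rw [pderiv_mul]
    convert! add_mem (mul_mem hx hy') (mul_mem hx' hy) using 1
    ring

theorem X_smul_pderiv_nilpotent {i j : Fin 2} (hij : i ≠ j) (p : MvPolynomial (Fin 2) K) :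
    ∃ n, ((X i : MvPolynomial (Fin 2) K) • pderiv j :
      Derivation K (MvPolynomial (Fin 2) K) (MvPolynomial (Fin 2) K))^[n] p = 0 := by
  set d : Derivation K (MvPolynomial (Fin 2) K) (MvPolynomial (Fin 2) K) :=
    (X i : MvPolynomial (Fin 2) K) • pderiv j with hd
  have h1 : (⊤ : Subalgebra K (MvPolynomial (Fin 2) K)) ≤ d.nilSubalgebra := by
    rw [← MvPolynomial.adjoin_range_X]
    refine Algebra.adjoin_le ?_
    rintro _ ⟨l, rfl⟩
    refine ⟨2, ?_⟩
    by_cases hl : l = j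
    · subst hl
      simp [hd, pderiv_X, hij]
    · simp [hd, pderiv_X, hl]
  exact h1 (Algebra.mem_top (x := p))

theorem mem_range_of_mem_makarLimanov [CharZero K] {b : linearFormsSubalgebra k T}
    (hb : b ∈ makarLimanov (linearFormsSubalgebra k T)) :
    b ∈ (algebraMap k (linearFormsSubalgebra k T)).range := by
  have hpd (i j : Fin 2) (hij : i ≠ j) : pderiv j (b : MvPolynomial (Fin 2) K) = 0 := by
    set d : Derivation K (MvPolynomial (Fin 2) K) (MvPolynomial (Fin 2) K) :=
      (X i : MvPolynomial (Fin 2) K) • pderiv j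
    obtain ⟨D, hD⟩ := exists_restrict_derivation (linearFormsSubalgebra k T).val.toRingHom
      Subtype.val_injective d fun p => ⟨⟨X i * pderiv j (p : MvPolynomial (Fin 2) K),
        X_mul_pderiv_mem p.2⟩, rfl⟩
    replace hD (p : linearFormsSubalgebra k T) : (D p : MvPolynomial (Fin 2) K) = d p := hD p
    have hiter (n : ℕ) (p : linearFormsSubalgebra k T) :
        ((D^[n] p : linearFormsSubalgebra k T) : MvPolynomial (Fin 2) K) = d^[n] p := by
      induction n generalizing p with
      | zero => rfl
      | succ n ih => rw [Function.iterate_succ_apply, ih, hD, Function.iterate_succ_apply]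
    have h := mem_kerInter.mp hb D fun p => by
      obtain ⟨n, hn⟩ := X_smul_pderiv_nilpotent hij (p : MvPolynomial (Fin 2) K)
      exact ⟨n, Subtype.ext (by rw [hiter]; exact hn)⟩
    have h' : X i * pderiv j (b : MvPolynomial (Fin 2) K) = 0 :=
      (hD b).symm.trans (congrArg Subtype.val h)
    exact (mul_eq_zero.mp h').resolve_left (X_ne_zero i)
  have hC := eq_C_of_pderiv_eq_zero (p := (b : MvPolynomial (Fin 2) K)) fun j => by
    fin_cases j
    · exact hpd 1 0 (by decide)
    · exact hpd 0 1 (by decide)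
  obtain ⟨a, ha⟩ := constantCoeff_mem_range b.2
  refine ⟨a, Subtype.ext ?_⟩
  rw [hC, ← ha]
  exact IsScalarTower.algebraMap_apply k K (MvPolynomial (Fin 2) K) a

end Construction

/-! ### The three implications -/

section Equivalence

variable {k L : Type*} [Field k] [Field L] [Algebra k L]

theorem isFractionRing_of_adjoin_eq_top {B : Subalgebra k L}
    (hB : IntermediateField.adjoin k (B : Set L) = ⊤) : IsFractionRing B L :=
  IsFractionRing.of_field _ _ fun z => by
    have hz : z ∈ IntermediateField.adjoin k (B : Set L) := hB ▸ IntermediateField.mem_top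
    obtain ⟨x, hx, y, hy, h⟩ := IntermediateField.mem_adjoin_iff_div.mp hz
    rw [Algebra.adjoin_eq] at hx hy
    exact ⟨⟨x, hx⟩, ⟨y, hy⟩, h⟩

theorem trdeg_le_one_of_adjoin_eq_top {r : L} (hr : IntermediateField.adjoin k {r} = ⊤) :
    Algebra.trdeg k L ≤ 1 := by
  have : Algebra.IsAlgebraic (Algebra.adjoin k {r}) L := ⟨fun z => by
    have hz : z ∈ IntermediateField.adjoin k {r} := hr ▸ IntermediateField.mem_top
    obtain ⟨x, hx, y, hy, rfl⟩ := IntermediateField.mem_adjoin_iff_div.mp hz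
    rw [div_eq_mul_inv]
    exact (isAlgebraic_algebraMap (⟨x, hx⟩ : Algebra.adjoin k {r})).mul
      (isAlgebraic_algebraMap (⟨y, hy⟩ : Algebra.adjoin k {r})).inv⟩
  simpa using Algebra.IsAlgebraic.trdeg_le_cardinalMk k ({r} : Set L)

variable [CharZero L]

theorem makarLimanov_eq_range_of_le {B : Subalgebra k L}
    (h : makarLimanov B ≤ (algebraMap k B).range) : makarLimanov B = (algebraMap k B).range := by
  refine le_antisymm h ?_
  rintro _ ⟨c, rfl⟩
  exact mem_kerInter.mpr fun D hD => apply_algebraMap_eq_zero hD c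

/-- `T` collects `1` and the coefficients of fractions representing generators of `L`. The fraction
field contains each `c = (c * X₀) / X₀`, hence those generators. -/
theorem exists_makarLimanov_eq_range (hfg : (⊤ : IntermediateField k L).FG)
    {K : IntermediateField k L} (hK : IsRationalFunctionField K L 2) :
    ∃ B : Subalgebra k L, Algebra.FiniteType k B ∧ IsFractionRing B L ∧
      makarLimanov B = (algebraMap k B).range := by
  classical
  obtain ⟨e⟩ := hK
  obtain ⟨S, hS⟩ := hfg
  let ι : MvPolynomial (Fin 2) K →ₐ[K] L :=
    e.toAlgHom.comp (Algebra.algHom K (MvPolynomial (Fin 2) K)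
      (FractionRing (MvPolynomial (Fin 2) K)))
  have hι : Function.Injective ι :=
    e.injective.comp (IsFractionRing.injective (MvPolynomial (Fin 2) K) _)
  have hdiv (z : L) : ∃ p q, z = ι p / ι q := by
    obtain ⟨p, q, -, hpq⟩ := IsFractionRing.div_surjective (A := MvPolynomial (Fin 2) K) (e.symm z)
    refine ⟨p, q, ?_⟩
    rw [← e.apply_symm_apply z, ← hpq, map_div₀]
    rfl
  choose p q hpq using hdiv
  set T : Finset K := insert 1 (S.biUnion fun z => (p z).coeffs ∪ (q z).coeffs) with hT
  have h1T : (1 : K) ∈ (T : Set K) := by simp [hT]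
  let B := (linearFormsSubalgebra k (T : Set K)).map (ι.restrictScalars k)
  have hBmem {c : K} (hc : c ∈ T) (i : Fin 2) : (c : L) * ι (MvPolynomial.X i) ∈ B := by
    refine ⟨_, C_mul_X_mem_linearFormsSubalgebra (k := k) (Finset.mem_coe.mpr hc) i, ?_⟩
    change ι _ = _
    rw [map_mul, ← MvPolynomial.algebraMap_eq, ι.commutes]
    rfl
  have hX (i : Fin 2) : ι (MvPolynomial.X i) ∈ B := by
    simpa using hBmem (Finset.mem_coe.mp h1T) i
  refine ⟨B, ?_, ?_, makarLimanov_eq_range_of_le fun b hb => ?_⟩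
  · exact (Subalgebra.fg_iff_finiteType B).mp
      ((fg_linearFormsSubalgebra T.finite_toSet).map _)
  · refine isFractionRing_of_adjoin_eq_top ?_
    set M := IntermediateField.adjoin k (B : Set L)
    have hBM : (B : Set L) ⊆ M := IntermediateField.subset_adjoin _ _
    have hcM {c : K} (hc : c ∈ T) : (c : L) ∈ M := by
      have h0 : ι (MvPolynomial.X 0) ≠ 0 :=
        (map_ne_zero_iff ι hι).mpr (MvPolynomial.X_ne_zero 0)
      rw [← mul_div_cancel_right₀ (c : L) h0]
      exact div_mem (hBM (hBmem hc 0)) (hBM (hX 0))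
    have hpM (p : MvPolynomial (Fin 2) K) (hp : p.coeffs ⊆ T) : ι p ∈ M := by
      rw [MvPolynomial.as_sum p, map_sum]
      refine sum_mem fun m hm => ?_
      rw [MvPolynomial.monomial_eq, map_mul, ← MvPolynomial.algebraMap_eq, ι.commutes,
        Finsupp.prod, map_prod]
      refine mul_mem (hcM (hp (MvPolynomial.coeff_mem_coeffs m (MvPolynomial.mem_support_iff.mp hm))))
        (prod_mem fun i _ => ?_)
      rw [map_pow]
      exact pow_mem (hBM (hX i)) _
    rw [eq_top_iff, ← hS]
    refine IntermediateField.adjoin_le_iff.mpr fun z hz => ?_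
    have hsub : (p z).coeffs ∪ (q z).coeffs ⊆ T :=
      (Finset.subset_biUnion_of_mem (fun z => (p z).coeffs ∪ (q z).coeffs) hz).trans
        (Finset.subset_insert _ _)
    rw [hpq z]
    exact div_mem (hpM _ (Finset.union_subset_left hsub)) (hpM _ (Finset.union_subset_right hsub))
  · let ε : linearFormsSubalgebra k (T : Set K) ≃ₐ[k] B :=
      (linearFormsSubalgebra k (T : Set K)).equivMapOfInjective (ι.restrictScalars k) hι
    obtain ⟨a, ha⟩ := mem_range_of_mem_makarLimanov (map_mem_makarLimanov ε.toRingEquiv hb)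
    refine ⟨a, ?_⟩
    rw [← ε.commutes, ha]
    exact ε.apply_symm_apply b

/-- Semi-rigidity makes `ML(B)` the kernel of any single nonzero `D`. The constants of `D` in `L`
are generated over `k` by kernel elements, so they reduce to `k`, and `L` is generated by a slice.
-/
theorem not_isSemiRigid_of_makarLimanov_eq_range (htrdeg : 2 ≤ Algebra.trdeg k L)
    {B : Subalgebra k L} (hB : B.FG) [IsFractionRing B L]
    (hML : makarLimanov B = (algebraMap k B).range) : ¬ IsSemiRigid B := by
  intro hrigid
  suffices h : ∃ r : L, IntermediateField.adjoin k {r} = ⊤ by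
    obtain ⟨r, hr⟩ := h
    exact absurd (htrdeg.trans (trdeg_le_one_of_adjoin_eq_top hr)) (by norm_num)
  by_cases h : ∀ D ∈ LND B, D = 0
  -- With no nonzero derivation, `B = ML(B) = k`, so `L = k` and any generator will do.
  · refine ⟨0, adjoin_eq_top_of_isFractionRing (B := B) (S := B) (Algebra.adjoin_eq B)
      fun b hb => ?_⟩
    have hb' : (⟨b, hb⟩ : B) ∈ makarLimanov B := mem_kerInter.mpr fun D hD => by rw [h D hD]; rfl
    rw [hML] at hb'
    obtain ⟨c, hc⟩ := hb'
    have : b = algebraMap k L c := (congrArg Subtype.val hc).symm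
    rw [this]
    exact IntermediateField.algebraMap_mem _ c
  · push Not at h
    obtain ⟨D, hD, hD0⟩ := h
    have hker {D' : Derivation ℤ B B} (hD' : D' ∈ LND B) (h0 : D' ≠ 0) :
        derivationKer D' ∈ kerLatticeOfTrdeg B 1 :=
      ⟨⟨{D'}, by simpa using hD', kerInter_singleton.symm⟩, by
        rw [trdeg_derivationKer hD' h0, Nat.cast_one]⟩
    have hkerML {a : B} (ha : D a = 0) : a ∈ (algebraMap k B).range := by
      rw [← hML]
      refine mem_kerInter.mpr fun D' hD' => ?_
      by_cases h0 : D' = 0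
      · rw [h0]; rfl
      · have heq := Set.encard_le_one_iff.mp hrigid _ _ (hker hD hD0) (hker hD' h0)
        exact (heq ▸ ha : a ∈ derivationKer D')
    obtain ⟨r, hr, hr2⟩ := exists_local_slice hD hD0
    obtain ⟨E, hE⟩ := exists_extend hD
    obtain ⟨-, htop, T, hT, hTker⟩ := exists_generators_of_slice hB hD hE hr hr2
    have hbot : E.constField = ⊥ := by
      rw [← hT, eq_bot_iff]
      refine IntermediateField.adjoin_le_iff.mpr fun c hc => ?_
      obtain ⟨a, ha, rfl⟩ := hTker c hc
      obtain ⟨b, rfl⟩ := hkerML ha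
      exact (⊥ : IntermediateField k L).algebraMap_mem b
    refine ⟨r, eq_top_iff.mpr fun x _ => ?_⟩
    have hx : x ∈ IntermediateField.adjoin E.constField {(r : L)} :=
      htop ▸ IntermediateField.mem_top
    induction hx using IntermediateField.adjoin_induction with
    | mem x hx => exact IntermediateField.subset_adjoin _ _ hx
    | algebraMap a =>
      have ha : (a : L) ∈ (⊥ : IntermediateField k L) := hbot ▸ a.2
      exact (bot_le : ⊥ ≤ IntermediateField.adjoin k {(r : L)}) ha
    | add x y _ _ hx hy => exact add_mem (hx trivial) (hy trivial)
    | inv x _ hx => exact inv_mem (hx trivial)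
    | mul x y _ _ hx hy => exact mul_mem (hx trivial) (hy trivial)

theorem exists_isRationalFunctionField_of_not_isSemiRigid {B : Subalgebra k L} (hB : B.FG)
    [IsFractionRing B L] (h : ¬ IsSemiRigid B) :
    ∃ K : IntermediateField k L, IsRationalFunctionField K L 2 := by
  rw [IsSemiRigid, Set.encard_le_one_iff] at h
  push Not at h
  obtain ⟨A₁, A₂, hA₁, hA₂, hne⟩ := h
  obtain ⟨D₁, hD₁, hD₁0, rfl⟩ := eq_derivationKer_of_trdeg_eq_one hA₁
  obtain ⟨D₂, hD₂, hD₂0, rfl⟩ := eq_derivationKer_of_trdeg_eq_one hA₂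
  by_cases hle : derivationKer D₂ ≤ derivationKer D₁
  · obtain ⟨f, hf₁, hf₂⟩ := SetLike.not_le_iff_exists.mp fun h => hne (le_antisymm h hle)
    exact exists_isRationalFunctionField_of_lnd hB hD₂ hD₁ hD₁0 hf₂ hf₁
  · obtain ⟨f, hf₂, hf₁⟩ := SetLike.not_le_iff_exists.mp hle
    exact exists_isRationalFunctionField_of_lnd hB hD₁ hD₂ hD₂0 hf₁ hf₂

end Equivalence

theorem mainTheorem10 {k L : Type*} [Field k] [Field L] [Algebra k L] [CharZero k] [CharZero L]
    (hfg : (⊤ : IntermediateField k L).FG) (htrdeg : 2 ≤ Algebra.trdeg k L) :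
    List.TFAE [
      ∃ B : Subalgebra k L, Algebra.FiniteType k B ∧ IsFractionRing B L ∧
        makarLimanov B = (algebraMap k B).range,
      ∃ B : Subalgebra k L, Algebra.FiniteType k B ∧ IsFractionRing B L ∧
        ¬ IsSemiRigid B,
      ∃ K : IntermediateField k L, IsRationalFunctionField K L 2] := by
  tfae_have 1 → 2 := fun ⟨B, hB, _, hML⟩ => ⟨B, hB, ‹_›,
    not_isSemiRigid_of_makarLimanov_eq_range htrdeg ((Subalgebra.fg_iff_finiteType B).mpr hB) hML⟩
  tfae_have 2 → 3 := fun ⟨B, hB, _, h⟩ =>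
    exists_isRationalFunctionField_of_not_isSemiRigid ((Subalgebra.fg_iff_finiteType B).mpr hB) h
  tfae_have 3 → 1 := fun ⟨_, hK⟩ => exists_makarLimanov_eq_range hfg hK
  tfae_finish
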